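/- Let $f(\mathbf z,\bar{\mathbf z})=\sum_{\nu,\mu}c_{\nu\mu}\mathbf z^{\nu}\bar{\mathbf z}^{\mu}$ be a mixed polynomial on $\mathbb C^n=\mathbb R^{2n}$. Put $V_\eta=f^{-1}(\eta)$ for $\eta\in\mathbb C$ and $V=V_0$; let $S_r$ and $B_r$ be the sphere and the closed ball of radius $r$ about $\mathbf 0$. A point $\mathbf p$ is a mixed singular point of the fiber through it if it is a critical point of $f:\mathbb R^{2n}\to\mathbb R^2$. We say that the nearby fibers are smooth in $B_r$ for $0<|\eta|\le\delta$ if no $V_\eta$ with $0<|\eta|\le\delta$ has a mixed singular point in $B_r$. We say that $f$ satisfies Thom's $a_f$-condition at $\mathbf 0$ if there is a Whitney regular stratification $\mathcal S$ of $\mathbb C^n$ (a locally finite partition into smooth submanifolds, any two of which satisfy Whitney's condition (b)) such that $V$ is a union of strata, together with numbers $r>0$ and $\delta>0$ such that the nearby fibers are smooth in $B_r$ for $0<|\eta|\le\delta$ and the following holds: if $\mathbf z^{(k)}\in B_r$ is a sequence with $0<|f(\mathbf z^{(k)})|\le\delta$ that converges to a point $\mathbf w\ne\mathbf 0$ of a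 stratum $M\subset V$, and if the tangent spaces $T_{\mathbf z^{(k)}}f^{-1}(f(\mathbf z^{(k)}))$ converge in the Grassmannian to a subspace $\tau$, then $T_{\mathbf w}M\subset\tau$. Assume that $f$ satisfies the $a_f$-condition at $\mathbf 0$ and that the nearby fibers are smooth in $B_r$ for $0<|\eta|\le\delta$, for some $r,\delta>0$. Then there exists $r_0>0$ such that for every $r_1$ with $0<r_1\le r_0$ there exists $\delta>0$ such that for every $\eta$ with $0<|\eta|\le\delta$ and every $r$ with $r_1\le r\le r_0$ the fiber $V_\eta$ intersects the sphere $S_r$ transversely; that is, every $\mathbf p\in V_\eta\cap S_r$ is a non-singular point of $V_\eta$ and $T_{\mathbf p}V_\eta+T_{\mathbf p}S_r=\mathbb R^{2n}$. -/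

import Mathlib

open Set Filter Topology
open scoped ContDiff

noncomputable section

namespace MixedFunction

/-- `ℂⁿ` with its Hermitian norm. As a real vector space it is `ℝ²ⁿ` with the Euclidean inner
product `Re (z, w)`. -/
abbrev Cn (n : ℕ) : Type := EuclideanSpace ℂ (Fin n)

/-! ### Submanifolds, tangent spaces, limits of subspaces -/

/-- `M` is a smooth (embedded, locally closed) submanifold of `ℂⁿ = ℝ²ⁿ`: near each of its points
it is the zero set of a smooth submersion. Components may have different dimensions. -/
def IsSmoothSubmanifold {n : ℕ} (M : Set (Cn n)) : Prop :=
  ∀ p ∈ M, ∃ (k : ℕ) (U : Set (Cn n)) (g : Cn n → EuclideanSpace ℝ (Fin k)),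
    IsOpen U ∧ p ∈ U ∧ ContDiffOn ℝ ∞ g U ∧
      (∀ x ∈ U, Function.Surjective (fderiv ℝ g x)) ∧ M ∩ U = {x ∈ U | g x = 0}

/-- The real tangent space `T_p M`, spanned by the velocities at `p` of the curves in `M` through
`p`. (Where `M` is a submanifold the velocities already form a linear subspace.) -/
def tangentSpace {n : ℕ} (M : Set (Cn n)) (p : Cn n) : Submodule ℝ (Cn n) :=
  Submodule.span ℝ
    {v | ∃ γ : ℝ → Cn n, γ 0 = p ∧ (∀ᶠ t in 𝓝 (0 : ℝ), γ t ∈ M) ∧ HasDerivAt γ v 0}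

/-- Convergence `W k → τ` in the Grassmannian of real linear subspaces of `ℂⁿ`: the orthogonal
projections onto `W k` converge to the orthogonal projection onto `τ`. -/
def TendstoSubspace {n : ℕ} (W : ℕ → Submodule ℝ (Cn n)) (τ : Submodule ℝ (Cn n)) : Prop :=
  Tendsto (fun k => (W k).starProjection) atTop (𝓝 τ.starProjection)

/-! ### Whitney regular stratifications -/

/-- Whitney's condition (b) for the pair `(Y, X)` at every point of `X`; it implies Whitney's
condition (a). -/
def WhitneyRegular {n : ℕ} (Y X : Set (Cn n)) : Prop :=
  ∀ (x : Cn n) (xs ys : ℕ → Cn n) (l τ : Submodule ℝ (Cn n)),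
    x ∈ X → (∀ k, xs k ∈ X) → (∀ k, ys k ∈ Y) → (∀ k, xs k ≠ ys k) →
    Tendsto xs atTop (𝓝 x) → Tendsto ys atTop (𝓝 x) →
    TendstoSubspace (fun k => Submodule.span ℝ {ys k - xs k}) l →
    TendstoSubspace (fun k => tangentSpace Y (ys k)) τ → l ≤ τ

/-- `S` is a Whitney regular stratification of `ℂⁿ`: a locally finite partition into smooth
submanifolds (the strata), any two of which satisfy Whitney's regularity condition. -/
structure IsWhitneyStratification {n : ℕ} (S : Set (Set (Cn n))) : Prop where
  isPartition : Setoid.IsPartition S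
  locallyFinite : LocallyFinite (fun M : S => (M : Set (Cn n)))
  smooth : ∀ M ∈ S, IsSmoothSubmanifold M
  whitney : ∀ Y ∈ S, ∀ X ∈ S, Y ≠ X → WhitneyRegular Y X

/-! ### Mixed polynomials -/

/-- The function `z ↦ ∑ c_{νμ} z^ν z̄^μ` on `ℂⁿ` given by a polynomial `F = ∑ c_{νμ} u^ν v^μ` in
`2n` variables; the left variables are the `u_j`, the right ones the `v_j`. -/
def mixedPolynomial {n : ℕ} (F : MvPolynomial (Fin n ⊕ Fin n) ℂ) (z : Cn n) : ℂ :=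
  MvPolynomial.eval (Sum.elim (fun j => z j) (fun j => (starRingEnd ℂ) (z j))) F

/-- The fiber `V_η = f⁻¹(η)`. -/
def fiber {n : ℕ} (f : Cn n → ℂ) (η : ℂ) : Set (Cn n) := {z | f z = η}

/-- `p` is a mixed singular point of the fiber of `f` through `p`: a critical point of
`f : ℝ²ⁿ → ℝ²`, i.e. the real differential of `f` at `p` is not onto. -/
def IsMixedSingular {n : ℕ} (f : Cn n → ℂ) (p : Cn n) : Prop :=
  ¬ Function.Surjective (fderiv ℝ f p)

/-- All fibers `V_η` with `0 < |η| ≤ δ` are smooth in the ball `B_r`. -/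
def NearbyFibersSmooth {n : ℕ} (f : Cn n → ℂ) (r δ : ℝ) : Prop :=
  ∀ η : ℂ, 0 < ‖η‖ → ‖η‖ ≤ δ →
    ∀ z ∈ fiber f η ∩ Metric.closedBall 0 r, ¬ IsMixedSingular f z

/-- Thom's `a_f`-condition for `f` with respect to `S`, locally at the origin. The sequences run
through the nearby fibers in a small ball and converge to a point `w ≠ 0` of a stratum `M ⊆ V_0`. -/
def ThomCondition {n : ℕ} (f : Cn n → ℂ) (S : Set (Set (Cn n))) : Prop :=
  ∃ r > 0, ∃ δ > 0, NearbyFibersSmooth f r δ ∧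
    ∀ M ∈ S, M ⊆ fiber f 0 → ∀ w ∈ M, w ≠ 0 →
      ∀ (z : ℕ → Cn n) (τ : Submodule ℝ (Cn n)),
        (∀ k, z k ∈ Metric.closedBall 0 r) → (∀ k, 0 < ‖f (z k)‖ ∧ ‖f (z k)‖ ≤ δ) →
        Tendsto z atTop (𝓝 w) →
        TendstoSubspace (fun k => tangentSpace (fiber f (f (z k))) (z k)) τ →
        tangentSpace M w ≤ τ

/-- `f` satisfies the `a_f`-condition at the origin: it does so with respect to some Whitney
regular stratification of `ℂⁿ` for which `V_0 = f⁻¹(0)` is a union of strata. -/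
def SatisfiesThomCondition {n : ℕ} (f : Cn n → ℂ) : Prop :=
  ∃ S : Set (Set (Cn n)), IsWhitneyStratification S ∧
    (∃ T ⊆ S, fiber f 0 = ⋃₀ T) ∧ ThomCondition f S

/-- `V_η` meets the sphere `S_r` of radius `r` about the origin transversely: at every common point
`p`, the fiber is smooth and `T_p V_η + T_p S_r = ℝ²ⁿ`. -/
def MeetsSphereTransversely {n : ℕ} (f : Cn n → ℂ) (η : ℂ) (r : ℝ) : Prop :=
  ∀ p ∈ fiber f η ∩ Metric.sphere 0 r, ¬ IsMixedSingular f p ∧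
    tangentSpace (fiber f η) p ⊔ tangentSpace (Metric.sphere 0 r) p = ⊤

end MixedFunction

end

noncomputable section

/-! Two transversality facts meet. Small spheres are transverse to every stratum: for the stratum
through the origin this is the submersion estimate `eventually_not_ker_fderiv_le_orthogonal`, for
the others Whitney's condition (b) along secants from the origin, and local finiteness leaves
finitely many strata. If the theorem failed, fibers with `η → 0` would have tangent spaces
orthogonal to points `z k` with `r₁ ≤ ‖z k‖ ≤ r₀`. These accumulate at some `w ≠ 0` in `V`, and by
compactness of the Grassmannian the tangent spaces accumulate at some `τ` orthogonal to `w`. Thom's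
condition puts the tangent space of the stratum of `w` inside `τ`, against the first fact. -/

namespace MixedFunction

/-! ### Subspaces and submersions in inner product spaces. -/

section InnerProduct

variable {E F : Type*} [NormedAddCommGroup E] [InnerProductSpace ℝ E]
  [NormedAddCommGroup F] [NormedSpace ℝ F]

/-- Sequential compactness of the Grassmannian. -/
theorem exists_subseq_tendsto_starProjection [FiniteDimensional ℝ E] (W : ℕ → Submodule ℝ E) :
    ∃ (τ : Submodule ℝ E) (φ : ℕ → ℕ), StrictMono φ ∧
      Tendsto (fun k => (W (φ k)).starProjection) atTop (𝓝 τ.starProjection) := by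
  have : ProperSpace (E →L[ℝ] E) := FiniteDimensional.proper ℝ _
  obtain ⟨P, -, φ, hφ, hP⟩ := (isCompact_closedBall (0 : E →L[ℝ] E) 1).tendsto_subseq
    (x := fun k => (W k).starProjection)
    (fun k => by simpa using (W k).starProjection_norm_le)
  -- Idempotence and self-adjointness are closed conditions, so they pass to the limit.
  have hproj : IsStarProjection P := by
    constructor
    · have h1 : Tendsto (fun k => (W (φ k)).starProjection * (W (φ k)).starProjection) atTop
          (𝓝 (P * P)) := Tendsto.mul hP hP
      refine tendsto_nhds_unique h1 (hP.congr fun k => ?_)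
      exact (W (φ k)).isIdempotentElem_starProjection.eq.symm
    · have h1 : Tendsto (fun k => star (W (φ k)).starProjection) atTop (𝓝 (star P)) :=
        (continuous_star.tendsto P).comp hP
      refine tendsto_nhds_unique h1 (hP.congr fun k => ?_)
      exact (isSelfAdjoint_starProjection (W (φ k))).star_eq.symm
  obtain ⟨_, h⟩ := isStarProjection_iff_eq_starProjection_range.1 hproj
  exact ⟨P.range, φ, hφ, h ▸ hP⟩

/-- Near a point where `g` is a submersion, no secant from that point within the level set of `g`
is orthogonal to the kernel of the derivative of `g`. -/
theorem eventually_not_ker_fderiv_le_orthogonal [FiniteDimensional ℝ E]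
    [FiniteDimensional ℝ F] {g : E → F} {p : E}
    (hg : ContDiffAt ℝ 1 g p) (hsurj : Function.Surjective (fderiv ℝ g p)) :
    ∀ᶠ w in 𝓝 p, g w = g p → w ≠ p →
      ¬ (fderiv ℝ g w).ker ≤ (Submodule.span ℝ {w - p})ᗮ := by
  have : CompleteSpace F := FiniteDimensional.complete ℝ F
  have : CompleteSpace E := FiniteDimensional.complete ℝ E
  have hA : ContinuousAt (fderiv ℝ g) p := hg.continuousAt_fderiv one_ne_zero
  obtain ⟨R, hR⟩ := (fderiv ℝ g p).exists_rightInverse_of_surjective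
    (LinearMap.range_eq_top.2 hsurj)
  -- `B w` is a right inverse of the derivative at `w`, continuous at `p` and hence bounded near it.
  set B : E → F →L[ℝ] E := fun w => R.comp (Ring.inverse ((fderiv ℝ g w).comp R)) with hB
  have hAR : ContinuousAt (fun w => (fderiv ℝ g w).comp R) p := hA.clm_comp continuousAt_const
  have hunit : ∀ᶠ w in 𝓝 p, IsUnit ((fderiv ℝ g w).comp R) := by
    refine hAR.eventually (p := fun T : F →L[ℝ] F => IsUnit T) ?_
    simp only [hR]
    exact Units.isOpen.mem_nhds isUnit_one
  have hBc : ContinuousAt B p := by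
    refine continuousAt_const.clm_comp (ContinuousAt.comp (g := Ring.inverse) ?_ hAR)
    rw [hR]
    exact NormedRing.inverse_continuousAt (1 : (F →L[ℝ] F)ˣ)
  obtain ⟨C, hC0, hC⟩ : ∃ C : ℝ, 0 < C ∧ ∀ᶠ w in 𝓝 p, ‖B w‖ < C :=
    ⟨‖B p‖ + 1, by positivity, hBc.norm.eventually_lt_const (by linarith)⟩
  -- Linearization error and variation of the derivative each cost `‖v‖ / (4 * C)`. Applying `B w`
  -- then gives a vector of norm at most `‖v‖ / 2`, while orthogonality of `v` to the kernel would
  -- require at least `‖v‖`.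
  have hε : 0 < 1 / (4 * C) := by positivity
  have hlin := (hg.differentiableAt one_ne_zero).hasFDerivAt.isLittleO.bound hε
  have hclose : ∀ᶠ w in 𝓝 p, ‖fderiv ℝ g w - fderiv ℝ g p‖ < 1 / (4 * C) := by
    have := (hA.sub (continuousAt_const (y := fderiv ℝ g p))).norm
    exact this.eventually_lt_const (by simpa using hε)
  filter_upwards [hunit, hC, hlin, hclose] with w hu hCw hl hc hgw hne hker
  set v := w - p with hv
  have hvpos : 0 < ‖v‖ := norm_pos_iff.2 (sub_ne_zero.2 hne)
  have hAB : ∀ y, fderiv ℝ g w (B w y) = y := fun y =>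
    congrArg (fun T : F →L[ℝ] F => T y) (Ring.mul_inverse_cancel _ hu)
  have hmem : v - B w (fderiv ℝ g w v) ∈ (fderiv ℝ g w).ker := by
    simp [LinearMap.mem_ker, hAB]
  have horth := (Submodule.mem_orthogonal_singleton_iff_inner_right).1 (hker hmem)
  rw [inner_sub_right, real_inner_self_eq_norm_sq, sub_eq_zero] at horth
  have h1 : ‖fderiv ℝ g w v‖ ≤ 1 / (2 * C) * ‖v‖ := by
    have e : fderiv ℝ g w v = (fderiv ℝ g w - fderiv ℝ g p) v -
        (g w - g p - fderiv ℝ g p v) := by simp [hgw]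
    have h2 := (fderiv ℝ g w - fderiv ℝ g p).le_of_opNorm_le hc.le v
    calc ‖fderiv ℝ g w v‖ ≤ 1 / (4 * C) * ‖v‖ + 1 / (4 * C) * ‖v‖ := by
          rw [e]; exact (norm_sub_le _ _).trans (add_le_add h2 hl)
      _ = 1 / (2 * C) * ‖v‖ := by field_simp; ring
  have h3 : ‖v‖ ^ 2 ≤ ‖v‖ * (C * (1 / (2 * C) * ‖v‖)) := by
    rw [horth]
    refine (real_inner_le_norm _ _).trans ?_
    gcongr
    exact ((B w).le_of_opNorm_le hCw.le _).trans (by gcongr)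
  have h4 : ‖v‖ * (C * (1 / (2 * C) * ‖v‖)) = ‖v‖ ^ 2 / 2 := by field_simp
  nlinarith [sq_pos_of_pos hvpos]

/-- If `T ⊔ pᗮ` is not the whole space, then `T` is orthogonal to `p`. -/
theorem le_orthogonal_singleton_of_sup_ne_top {T H : Submodule ℝ E} {p : E}
    (hH : (Submodule.span ℝ {p})ᗮ ≤ H) (h : T ⊔ H ≠ ⊤) : T ≤ (Submodule.span ℝ {p})ᗮ := by
  intro v hv
  by_contra hvp
  rw [Submodule.mem_orthogonal_singleton_iff_inner_right] at hvp
  refine h (eq_top_iff.2 fun x _ => ?_)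
  have hx : x - (inner ℝ p x / inner ℝ p v) • v ∈ (Submodule.span ℝ {p})ᗮ := by
    rw [Submodule.mem_orthogonal_singleton_iff_inner_right, inner_sub_right, inner_smul_right,
      div_mul_cancel₀ _ hvp, sub_self]
  have := Submodule.add_mem_sup (T.smul_mem (inner ℝ p x / inner ℝ p v) hv) (hH hx)
  simpa using this

end InnerProduct

variable {n : ℕ}

/-! ### Tangent spaces of level sets and spheres. -/

/-- The kernel of the derivative of a submersion is tangent to its zero set. -/
theorem ker_fderiv_le_tangentSpace {F : Type*} [NormedAddCommGroup F] [NormedSpace ℝ F]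
    [FiniteDimensional ℝ F] {M U : Set (Cn n)} {g : Cn n → F} {p : Cn n}
    (hU : IsOpen U) (hp : p ∈ M ∩ U) (hg : ContDiffAt ℝ 1 g p)
    (hsurj : Function.Surjective (fderiv ℝ g p)) (hM : M ∩ U = {x ∈ U | g x = 0}) :
    (fderiv ℝ g p).ker ≤ tangentSpace M p := by
  have : CompleteSpace F := FiniteDimensional.complete ℝ F
  intro v hv
  have hs : HasStrictFDerivAt g (fderiv ℝ g p) p := hg.hasStrictFDerivAt one_ne_zero
  have hr : (fderiv ℝ g p).range = ⊤ := LinearMap.range_eq_top.2 hsurj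
  have hgp : g p = 0 := (hM ▸ hp : p ∈ {x ∈ U | g x = 0}).2
  -- `ψ` parametrizes the level set by the kernel, with the inclusion as derivative at `0`; images
  -- of lines are the required curves.
  set ψ := hs.implicitFunction g (fderiv ℝ g p) hr (g p) with hψ
  let v' : (fderiv ℝ g p).ker := ⟨v, hv⟩
  have hψ0 : ψ 0 = p := hs.implicitFunction_apply_image hr
  have hψd : HasFDerivAt ψ (fderiv ℝ g p).ker.subtypeL 0 :=
    (hs.to_implicitFunction hr).hasFDerivAt
  have hline : HasDerivAt (fun t : ℝ => t • v') v' 0 := by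
    simpa using (hasDerivAt_id (0 : ℝ)).smul_const v'
  have hd : HasDerivAt (fun t : ℝ => ψ (t • v')) v 0 := by
    have : HasFDerivAt ψ (fderiv ℝ g p).ker.subtypeL ((fun t : ℝ => t • v') 0) := by
      simpa using hψd
    exact this.comp_hasDerivAt (0 : ℝ) hline
  refine Submodule.subset_span ⟨fun t => ψ (t • v'), by simpa using hψ0, ?_, hd⟩
  have hUt : ∀ᶠ t in 𝓝 (0 : ℝ), ψ (t • v') ∈ U :=
    hd.continuousAt.eventually_mem (hU.mem_nhds (by simpa [hψ0] using hp.2))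
  have hgt : ∀ᶠ t in 𝓝 (0 : ℝ), g (ψ (t • v')) = g p := by
    have h1 : Tendsto (fun t : ℝ => (g p, t • v')) (𝓝 0)
        (𝓝 (g p, (0 : (fderiv ℝ g p).ker))) := by
      rw [nhds_prod_eq]
      refine tendsto_const_nhds.prodMk ?_
      simpa using hline.continuousAt.tendsto
    exact h1.eventually (hs.map_implicitFunction_eq hr)
  filter_upwards [hUt, hgt] with t h1 h2
  exact (hM.symm ▸ (⟨h1, h2.trans hgp⟩ : ψ (t • v') ∈ {x ∈ U | g x = 0}) : _ ∈ M ∩ U).1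

/-- Vectors orthogonal to `p ≠ 0` are tangent at `p` to the sphere through `p`. -/
theorem orthogonal_le_tangentSpace_sphere {p : Cn n} (hp : p ≠ 0) :
    (Submodule.span ℝ {p})ᗮ ≤ tangentSpace (Metric.sphere 0 ‖p‖) p := by
  let g : Cn n → ℝ := fun x => ‖x‖ ^ 2 - ‖p‖ ^ 2
  have hd : HasFDerivAt g (2 • innerSL ℝ p) p :=
    (hasStrictFDerivAt_norm_sq p).hasFDerivAt.sub_const _
  have hpp : inner ℝ p p ≠ (0 : ℝ) := by simpa using hp
  refine le_trans ?_ (ker_fderiv_le_tangentSpace (g := g) isOpen_univ (by simp) ?_ ?_ ?_)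
  · intro v hv
    rw [Submodule.mem_orthogonal_singleton_iff_inner_right] at hv
    simp [hd.fderiv, LinearMap.mem_ker, hv]
  · exact ((contDiff_norm_sq ℝ).sub contDiff_const).contDiffAt
  · intro y
    refine ⟨(y / (2 * inner ℝ p p)) • p, ?_⟩
    rw [hd.fderiv]
    simp only [_root_.smul_apply, innerSL_apply_apply, inner_smul_right, nsmul_eq_mul]
    push_cast
    field_simp
  · ext x
    simp [g, sub_eq_zero]

/-! ### Small spheres and the strata. -/

/-- Small spheres about the origin are transverse to a stratum passing through the origin. -/
theorem IsSmoothSubmanifold.eventually_not_tangentSpace_le_orthogonal {M : Set (Cn n)}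
    (hM : IsSmoothSubmanifold M) (h0 : (0 : Cn n) ∈ M) :
    ∀ᶠ w in 𝓝 (0 : Cn n), w ∈ M → w ≠ 0 → ¬ tangentSpace M w ≤ (Submodule.span ℝ {w})ᗮ := by
  obtain ⟨k, U, g, hU, h0U, hg, hsurj, hMU⟩ := hM 0 h0
  have hgU : ∀ x ∈ U, ContDiffAt ℝ 1 g x := fun x hx =>
    (hg.contDiffAt (hU.mem_nhds hx)).of_le (by exact_mod_cast le_top)
  have hzero : ∀ x ∈ M, x ∈ U → g x = 0 := fun x hx hxU =>
    (hMU ▸ (⟨hx, hxU⟩ : x ∈ M ∩ U) : x ∈ {x ∈ U | g x = 0}).2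
  filter_upwards [hU.mem_nhds h0U,
    eventually_not_ker_fderiv_le_orthogonal (hgU 0 h0U) (hsurj 0 h0U)] with w hwU hw hwM hne hle
  refine hw ((hzero w hwM hwU).trans (hzero 0 h0 h0U).symm) hne ?_
  rw [sub_zero]
  exact (ker_fderiv_le_tangentSpace hU ⟨hwM, hwU⟩ (hgU w hwU) (hsurj w hwU) hMU).trans hle

/-- Small spheres about the origin are transverse to a stratum that is Whitney regular over a set
containing the origin. -/
theorem WhitneyRegular.eventually_not_tangentSpace_le_orthogonal {Y X : Set (Cn n)}
    (h : WhitneyRegular Y X) (h0 : (0 : Cn n) ∈ X) :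
    ∀ᶠ w in 𝓝 (0 : Cn n), w ∈ Y → w ≠ 0 → ¬ tangentSpace Y w ≤ (Submodule.span ℝ {w})ᗮ := by
  by_contra hcon
  obtain ⟨ys, hys, hP⟩ := exists_seq_forall_of_frequently (not_eventually.1 hcon)
  simp only [Classical.not_imp, not_not] at hP
  obtain ⟨l, φ, hφ, hl⟩ := exists_subseq_tendsto_starProjection
    fun k => Submodule.span ℝ {ys k}
  obtain ⟨τ, ψ, hψ, hτ⟩ := exists_subseq_tendsto_starProjection
    fun k => tangentSpace Y (ys (φ k))
  have hl' := hl.comp hψ.tendsto_atTop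
  -- Condition (b) with the sequence in `X` constantly `0`: the secants are the position vectors.
  have hle : l ≤ τ := by
    refine h 0 (fun _ => 0) (fun k => ys (φ (ψ k))) l τ h0 (fun _ => h0) (fun k => (hP _).1)
      (fun k => (hP _).2.1.symm) tendsto_const_nhds
      (hys.comp (hφ.comp hψ).tendsto_atTop) ?_ hτ
    simpa [TendstoSubspace, Function.comp_def] using hl'
  have hprod : τ.starProjection ∘L l.starProjection = 0 := by
    refine tendsto_nhds_unique (Tendsto.mul hτ hl') (tendsto_const_nhds.congr fun k => ?_)
    exact (Submodule.starProjection_comp_starProjection_eq_zero_iff.2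
      (Submodule.isOrtho_iff_le.2 (hP (φ (ψ k))).2.2)).symm
  have hzero : l.starProjection = 0 := by
    rw [← hprod]
    ext x
    simp [Submodule.starProjection_eq_self_iff.2 (hle (l.starProjection_apply_mem x))]
  -- A limit of projections onto lines keeps norm `1`, so `l` cannot vanish.
  have hnorm : ‖l.starProjection‖ = 1 := by
    refine tendsto_nhds_unique hl.norm (tendsto_const_nhds.congr fun k => ?_)
    exact (Submodule.norm_starProjection _ (by simpa using (hP (φ k)).2.1)).symm
  simp [hzero] at hnorm

/-- Small spheres about the origin are transverse to all strata of a Whitney stratification. -/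
theorem IsWhitneyStratification.eventually_not_tangentSpace_le_orthogonal {S : Set (Set (Cn n))}
    (hS : IsWhitneyStratification S) :
    ∀ᶠ w in 𝓝 (0 : Cn n), ∀ M ∈ S, w ∈ M → w ≠ 0 →
      ¬ tangentSpace M w ≤ (Submodule.span ℝ {w})ᗮ := by
  obtain ⟨X, ⟨hX, h0⟩, -⟩ := hS.isPartition.2 0
  obtain ⟨t, ht, hfin⟩ := hS.locallyFinite 0
  have hall : ∀ᶠ w in 𝓝 (0 : Cn n), ∀ M ∈ {M : S | ((M : Set (Cn n)) ∩ t).Nonempty},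
      w ∈ (M : Set (Cn n)) → w ≠ 0 →
        ¬ tangentSpace (M : Set (Cn n)) w ≤ (Submodule.span ℝ {w})ᗮ := by
    refine hfin.eventually_all.2 fun M _ => ?_
    -- Condition (b) covers only pairs of distinct strata, so the stratum through `0` needs its
    -- smoothness instead.
    rcases eq_or_ne (M : Set (Cn n)) X with hMX | hMX
    · rw [hMX]
      exact (hS.smooth X hX).eventually_not_tangentSpace_le_orthogonal h0
    · exact (hS.whitney M M.2 X hX hMX).eventually_not_tangentSpace_le_orthogonal h0
  filter_upwards [hall, ht] with w hw hwt M hM hwM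
  exact hw ⟨M, hM⟩ ⟨w, hwM, hwt⟩ hwM

/-! ### Limits of nearby fibers and the contradiction. -/

theorem continuous_mixedPolynomial (F : MvPolynomial (Fin n ⊕ Fin n) ℂ) :
    Continuous (mixedPolynomial F) := by
  refine F.continuous_eval.comp (continuous_pi fun i => ?_)
  rcases i with j | j
  · simpa using (by fun_prop : Continuous fun z : Cn n => z j)
  · exact Complex.continuous_conj.comp (by fun_prop : Continuous fun z : Cn n => z j)

/-- Consequence of Thom's condition: a sequence in the nearby fibers whose tangent spaces are
orthogonal to the position vector cannot converge to a point `w ≠ 0` of the zero fiber at which the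
sphere is transverse to the strata. -/
theorem exists_tangentSpace_le_orthogonal_of_tendsto {f : Cn n → ℂ} {M : Set (Cn n)} {w : Cn n}
    {z : ℕ → Cn n}
    (hThom : ∀ (φ : ℕ → ℕ) (τ : Submodule ℝ (Cn n)), StrictMono φ →
      TendstoSubspace (fun k => tangentSpace (fiber f (f (z (φ k)))) (z (φ k))) τ →
        tangentSpace M w ≤ τ)
    (hz : Tendsto z atTop (𝓝 w))
    (horth : ∀ k, tangentSpace (fiber f (f (z k))) (z k) ≤ (Submodule.span ℝ {z k})ᗮ) :
    tangentSpace M w ≤ (Submodule.span ℝ {w})ᗮ := by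
  obtain ⟨τ, φ, hφ, hτ⟩ := exists_subseq_tendsto_starProjection
    fun k => tangentSpace (fiber f (f (z k))) (z k)
  refine (hThom φ τ hφ hτ).trans ?_
  have hw : τ.starProjection w = 0 := by
    refine tendsto_nhds_unique ((isBoundedBilinearMap_apply.continuous.tendsto
      (τ.starProjection, w)).comp (hτ.prodMk_nhds (hz.comp hφ.tendsto_atTop)))
      (tendsto_const_nhds.congr fun k => ?_)
    symm
    refine (Submodule.starProjection_apply_eq_zero_iff _).2 fun v hv => ?_
    rw [real_inner_comm]
    exact Submodule.mem_orthogonal_singleton_iff_inner_right.1 (horth _ hv)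
  intro v hv
  rw [Submodule.mem_orthogonal_singleton_iff_inner_right, real_inner_comm]
  exact (Submodule.starProjection_apply_eq_zero_iff _).1 hw v hv

end MixedFunction

end

theorem mainTheorem6 (n : ℕ) (F : MvPolynomial (Fin n ⊕ Fin n) ℂ)
    (haf : MixedFunction.SatisfiesThomCondition (MixedFunction.mixedPolynomial F))
    (hsmooth : ∃ r > 0, ∃ δ > 0,
      MixedFunction.NearbyFibersSmooth (MixedFunction.mixedPolynomial F) r δ) :
    ∃ r₀ : ℝ, 0 < r₀ ∧ ∀ r₁ : ℝ, 0 < r₁ → r₁ ≤ r₀ →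
      ∃ δ : ℝ, 0 < δ ∧ ∀ η : ℂ, 0 < ‖η‖ → ‖η‖ ≤ δ → ∀ r : ℝ, r₁ ≤ r → r ≤ r₀ →
        MixedFunction.MeetsSphereTransversely (MixedFunction.mixedPolynomial F) η r := by
  obtain ⟨S, hS, ⟨T, hTS, hT⟩, r, hr, δ, hδ, hsm, hThom⟩ := haf
  set f := MixedFunction.mixedPolynomial F with hf
  obtain ⟨ε, hε, hεS⟩ :=
    Metric.eventually_nhds_iff_ball.1 hS.eventually_not_tangentSpace_le_orthogonal
  -- The bound `r` keeps the points where Thom's condition applies; `ε / 2` keeps their limit in the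
  -- open `ε`-ball.
  have hr0 : 0 < min r (ε / 2) := lt_min hr (half_pos hε)
  refine ⟨min r (ε / 2), hr0, fun r₁ hr₁ _ => ?_⟩
  by_contra hcon
  push Not at hcon
  have hpt : ∀ k : ℕ, ∃ p : MixedFunction.Cn n, (0 < ‖f p‖ ∧ ‖f p‖ ≤ δ) ∧ ‖f p‖ ≤ 1 / (k + 1) ∧
      r₁ ≤ ‖p‖ ∧ ‖p‖ ≤ min r (ε / 2) ∧
      MixedFunction.tangentSpace (MixedFunction.fiber f (f p)) p ≤ (Submodule.span ℝ {p})ᗮ := by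
    intro k
    -- The bound `1 / (k + 1)` forces `f` to vanish at the limit point.
    obtain ⟨η, hη, hηle, s, hs₁, hs₀, hnot⟩ := hcon (min δ (1 / (k + 1)))
      (lt_min hδ (by positivity))
    rw [MixedFunction.MeetsSphereTransversely] at hnot
    push Not at hnot
    obtain ⟨p, ⟨hpη, hps⟩, hp⟩ := hnot
    obtain rfl : f p = η := hpη
    obtain rfl : ‖p‖ = s := by simpa using hps
    have hpr : p ∈ Metric.closedBall (0 : MixedFunction.Cn n) r := by
      simpa using hs₀.trans (min_le_left _ _)
    refine ⟨p, ⟨hη, hηle.trans (min_le_left _ _)⟩, hηle.trans (min_le_right _ _), hs₁, hs₀, ?_⟩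
    exact MixedFunction.le_orthogonal_singleton_of_sup_ne_top
      (MixedFunction.orthogonal_le_tangentSpace_sphere (norm_pos_iff.1 (hr₁.trans_le hs₁)))
      (hp (hsm _ hη (hηle.trans (min_le_left _ _)) p ⟨rfl, hpr⟩))
  choose z hzδ hzk hz₁ hz₀ hzo using hpt
  obtain ⟨w, -, φ, hφ, hw⟩ := (isCompact_closedBall (0 : MixedFunction.Cn n) r).tendsto_subseq
    (x := z) fun k => by simpa using (hz₀ k).trans (min_le_left _ _)
  have hw₁ : r₁ ≤ ‖w‖ := ge_of_tendsto' hw.norm fun k => hz₁ _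
  have hw₀ : ‖w‖ ≤ min r (ε / 2) := le_of_tendsto' hw.norm fun k => hz₀ _
  have hwne : w ≠ 0 := norm_pos_iff.1 (hr₁.trans_le hw₁)
  have hfw : f w = 0 := by
    have h1 : Tendsto (fun k => f (z k)) atTop (𝓝 0) :=
      squeeze_zero_norm hzk tendsto_one_div_add_atTop_nhds_zero_nat
    exact tendsto_nhds_unique
      (((MixedFunction.continuous_mixedPolynomial F).tendsto w).comp hw)
      (h1.comp hφ.tendsto_atTop)
  have hwV : w ∈ MixedFunction.fiber f 0 := hfw
  rw [hT] at hwV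
  obtain ⟨M, hMT, hwM⟩ := hwV
  have hMV : M ⊆ MixedFunction.fiber f 0 := hT ▸ subset_sUnion_of_mem hMT
  refine hεS w ?_ M (hTS hMT) hwM hwne ?_
  · rw [mem_ball_zero_iff]
    linarith [min_le_right r (ε / 2)]
  · refine MixedFunction.exists_tangentSpace_le_orthogonal_of_tendsto (f := f) (z := z ∘ φ)
      (fun ψ τ hψ hτ => ?_) hw fun k => hzo _
    exact hThom M (hTS hMT) hMV w hwM hwne (fun k => z (φ (ψ k))) τ
      (fun k => by simpa using (hz₀ _).trans (min_le_left _ _)) (fun k => hzδ _)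
      (hw.comp hψ.tendsto_atTop) hτ
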